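/- Let $\sigma>0$, $c>0$ and $t\in\mathbb{R}$. Let $W_\sigma(x;t)=|x|^{2\sigma+1}\exp\left(-[cx^6+t(x^4-x^2)]\right)$ for $x\in\mathbb{R}$, let $\langle p,q\rangle=\int_{-\infty}^{\infty}p(x)q(x)W_\sigma(x;t)\,dx$, and let $(\mathcal S_n(x;t))_{n\ge 0}$ be the monic polynomials, $\deg \mathcal S_n=n$, orthogonal with respect to $\langle\cdot,\cdot\rangle$. They satisfy $\mathcal S_{n+1}=x\mathcal S_n-\gamma_n\mathcal S_{n-1}$ with $\gamma_n=\gamma_n(t;\sigma)=\langle x\mathcal S_n,\mathcal S_{n-1}\rangle/\langle \mathcal S_{n-1},\mathcal S_{n-1}\rangle$ for $n\ge 1$; put $\gamma_n=0$ for $n\le 0$. Let $\Omega_n=\frac{1-(-1)^n}{2}$, $\Xi_n=\gamma_n(\gamma_{n-1}+\gamma_n+\gamma_{n+1})$ and $$\vartheta(t)=4t\,\Xi_n-2t\gamma_n=2t\gamma_n\left[2(\gamma_{n-1}+\gamma_n+\gamma_{n+1})-1\right].$$ Then, for every integer $n\ge 0$, the function $t\mapsto\gamma_n(t;\sigma)$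 is twice differentiable on $\mathbb{R}$ and $$\begin{aligned} \frac{d^2\gamma_n}{dt^2}={}&\frac{1}{6c}\left[n+(2\sigma+1)\Omega_n-\vartheta(t)\right]+\left(-\gamma_{n-1}-\gamma_{n+1}\right)\gamma_n^4\\ &+\left(-\gamma_{n-2}\gamma_{n-1}-\gamma_{n-1}^2-6\gamma_{n-1}\gamma_{n+1}-\gamma_{n+1}^2-\gamma_{n+1}\gamma_{n+2}+2\gamma_{n-1}+2\gamma_{n+1}\right)\gamma_n^3\\ &+\Big(\gamma_{n-3}\gamma_{n-2}\gamma_{n-1}+\gamma_{n-2}^2\gamma_{n-1}+2\gamma_{n-2}\gamma_{n-1}^2-4\gamma_{n-2}\gamma_{n-1}\gamma_{n+1}+\gamma_{n-1}^3-5\gamma_{n-1}^2\gamma_{n+1}-4\gamma_{n-1}\gamma_{n+1}\gamma_{n+2}\\ &\quad-5\gamma_{n-1}\gamma_{n+1}^2+\gamma_{n+1}^3+2\gamma_{n+1}^2\gamma_{n+2}+\gamma_{n+1}\gamma_{n+2}^2+\gamma_{n+1}\gamma_{n+2}\gamma_{n+3}+8\gamma_{n-1}\gamma_{n+1}-\gamma_{n-1}-\gamma_{n+1}\Big)\gamma_n^2\\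 &+\Big(\gamma_{n-4}\gamma_{n-3}\gamma_{n-2}\gamma_{n-1}+\gamma_{n-3}^2\gamma_{n-2}\gamma_{n-1}+2\gamma_{n-3}\gamma_{n-2}^2\gamma_{n-1}+2\gamma_{n-3}\gamma_{n-2}\gamma_{n-1}^2+\gamma_{n-2}^3\gamma_{n-1}\\ &\quad+3\gamma_{n-2}^2\gamma_{n-1}^2+3\gamma_{n-2}\gamma_{n-1}^3-2\gamma_{n-2}\gamma_{n-1}\gamma_{n+1}^2-2\gamma_{n-2}\gamma_{n-1}\gamma_{n+1}\gamma_{n+2}+\gamma_{n-1}^4-2\gamma_{n-1}^2\gamma_{n+1}^2\\ &\quad-2\gamma_{n-1}^2\gamma_{n+1}\gamma_{n+2}+\gamma_{n+1}^4+3\gamma_{n+1}^3\gamma_{n+2}+3\gamma_{n+1}^2\gamma_{n+2}^2+2\gamma_{n+1}^2\gamma_{n+2}\gamma_{n+3}+\gamma_{n+1}\gamma_{n+2}^3\\ &\quad+2\gamma_{n+1}\gamma_{n+2}^2\gamma_{n+3}+\gamma_{n+1}\gamma_{n+2}\gamma_{n+3}^2-2\gamma_{n-2}^2\gamma_{n-1}+\gamma_{n+1}\gamma_{n+2}\gamma_{n+3}\gamma_{n+4}-2\gamma_{n-3}\gamma_{n-2}\gamma_{n-1}\\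 &\quad-4\gamma_{n-2}\gamma_{n-1}^2+2\gamma_{n-2}\gamma_{n-1}\gamma_{n+1}-2\gamma_{n-1}^3+2\gamma_{n-1}^2\gamma_{n+1}+2\gamma_{n-1}\gamma_{n+1}^2+2\gamma_{n-1}\gamma_{n+1}\gamma_{n+2}-2\gamma_{n+1}^3\\ &\quad-4\gamma_{n+1}^2\gamma_{n+2}-\gamma_n^2-2\gamma_{n+1}\gamma_{n+2}^2-2\gamma_{n+1}\gamma_{n+2}\gamma_{n+3}-2\gamma_{n-1}\gamma_{n+1}-2\gamma_n\gamma_{n-1}-2\gamma_n\gamma_{n+1}-\gamma_{n+1}\gamma_{n-1}\Big)\gamma_n . \end{aligned}$$ -/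

import Mathlib

open Polynomial MeasureTheory

noncomputable section

namespace PerturbedFreud

/-- The perturbed Freud weight `|x|^(2σ+1) exp(-[c x^6 + t (x^4 - x^2)])` on the real line. -/
def weight (σ c t x : ℝ) : ℝ :=
  |x| ^ (2 * σ + 1) * Real.exp (-(c * x ^ 6 + t * (x ^ 4 - x ^ 2)))

/-- The inner product `⟨p, q⟩ = ∫ p(x) q(x) W(x; t) dx` on real polynomials. -/
def innerW (σ c t : ℝ) (p q : ℝ[X]) : ℝ :=
  ∫ x : ℝ, p.eval x * q.eval x * weight σ c t x

/-- The monic orthogonal polynomials `S_n(x; t)` of the weight, by the Gram-Schmidt process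
applied (without normalisation) to the monomials `1, x, x^2, …`. -/
def orthoPoly (σ c t : ℝ) (n : ℕ) : ℝ[X] :=
  X ^ n - ∑ k : Fin n,
    C (innerW σ c t (X ^ n) (orthoPoly σ c t k) /
      innerW σ c t (orthoPoly σ c t k) (orthoPoly σ c t k)) * orthoPoly σ c t k
termination_by n
decreasing_by all_goals exact k.isLt

/-- The coefficient `γ_n(t)` of the three-term recurrence `S_{n+1} = x S_n - γ_n S_{n-1}`,
that is `γ_n = ⟨x S_n, S_{n-1}⟩ / ⟨S_{n-1}, S_{n-1}⟩` for `n ≥ 1`, with `γ_n = 0` for `n ≤ 0`. -/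
def gam (σ c : ℝ) : ℤ → ℝ → ℝ
  | .ofNat (m + 1), t =>
      innerW σ c t (X * orthoPoly σ c t (m + 1)) (orthoPoly σ c t m) /
        innerW σ c t (orthoPoly σ c t m) (orthoPoly σ c t m)
  | _, _ => 0

/-- `Ω_n = (1 - (-1)^n) / 2`. -/
def Om (n : ℕ) : ℝ := (1 - (-1) ^ n) / 2

/-- `Ξ_n = γ_n (γ_{n-1} + γ_n + γ_{n+1})`. -/
def Xi (σ c : ℝ) (n : ℤ) (t : ℝ) : ℝ :=
  gam σ c n t * (gam σ c (n - 1) t + gam σ c n t + gam σ c (n + 1) t)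

/-- `ϑ(t) = 4 t Ξ_n - 2 t γ_n`. -/
def vartheta (σ c : ℝ) (n : ℤ) (t : ℝ) : ℝ :=
  4 * t * Xi σ c n t - 2 * t * gam σ c n t

end PerturbedFreud

end

namespace PerturbedFreud

/-! Write L_t for integration against the weight and h_n = L_t(S_n²). The weight is even, so S_n has
the parity of n, the recurrence has no diagonal term, and γ_n = h_n/h_{n-1}. Two relations carry the
theorem.

Volterra equation (`hasDerivAt_gam`): ∂W/∂t = -(x⁴ - x²)W. Since S_n is monic, ∂S_n/∂t has degree
below n and drops out of h_n', leaving h_n' = -L_t((x⁴ - x²)S_n²). The recurrence turns this into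
γ's, and the quotient rule gives γ_n' = γ_n(Ξ_{n-1} - Ξ_{n+1} + γ_{n+1} - γ_{n-1}).

String equation (`string_equation`): integrating (S_{n+1}S_n W)' by parts expresses n + (2σ+1)Ω_n -
ϑ as 6c times a cubic polynomial in the γ's.

Differentiating the Volterra equation once more, and using it again for the neighbours, makes γ_n''
a polynomial in γ_{n-4}, …, γ_{n+4}. The string equation accounts for part of its cubic terms; the
rest is a polynomial identity. -/

/-! ### Domination and integrability of the weight -/

lemma integrable_abs_pow_mul_exp_neg_sq (k : ℕ) :
    Integrable fun x : ℝ => |x| ^ k * Real.exp (-x ^ 2) := by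
  have h := (integrable_rpow_mul_exp_neg_mul_sq one_pos
    (s := (k : ℝ)) (by have : (0 : ℝ) ≤ k := k.cast_nonneg
                       linarith)).norm
  refine h.congr (Filter.Eventually.of_forall fun x => ?_)
  simp [abs_of_pos (Real.exp_pos _)]

/-- The sextic term dominates the quartic and quadratic ones uniformly for bounded s; this
uniformity is what differentiation under the integral sign needs. -/
lemma exp_neg_sextic_le {c : ℝ} (hc : 0 < c) (T : ℝ) :
    ∃ C, ∀ s, |s| ≤ T → ∀ x : ℝ,
      Real.exp (-(c * x ^ 6 + s * (x ^ 4 - x ^ 2))) ≤ C * Real.exp (-x ^ 2) := by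
  -- Threshold for y = x²: beyond M, c y³ exceeds |T| y² + (|T| + 1) y; below M, that expression is
  -- at most its value at M.
  set M : ℝ := (2 * |T| + 1) / c + 1 with hM
  have hT := abs_nonneg T
  have hM1 : 1 ≤ M := by
    have : 0 ≤ (2 * |T| + 1) / c := by positivity
    linarith
  have hcM : 2 * |T| + 1 ≤ c * M := by
    rw [hM, mul_add, mul_div_cancel₀ _ hc.ne']; linarith
  refine ⟨Real.exp (|T| * M ^ 2 + (|T| + 1) * M), fun s hs x => ?_⟩
  rw [← Real.exp_add]
  apply Real.exp_le_exp.mpr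
  have hs' := abs_le.mp (hs.trans (le_abs_self T))
  obtain ⟨y, hy, hy0⟩ : ∃ y, y = x ^ 2 ∧ 0 ≤ y := ⟨_, rfl, sq_nonneg x⟩
  have h4 : x ^ 4 = y ^ 2 := by rw [hy]; ring
  have h6 : x ^ 6 = y ^ 3 := by rw [hy]; ring
  rw [h4, h6, ← hy]
  have key : |T| * y ^ 2 + (|T| + 1) * y ≤ c * y ^ 3 + (|T| * M ^ 2 + (|T| + 1) * M) := by
    rcases le_total M y with h | h
    · have h1 : (2 * |T| + 1) * y ^ 2 ≤ c * y * y ^ 2 :=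
        mul_le_mul_of_nonneg_right (hcM.trans (mul_le_mul_of_nonneg_left h hc.le)) (sq_nonneg y)
      have h2 : (|T| + 1) * y ≤ (|T| + 1) * y ^ 2 :=
        mul_le_mul_of_nonneg_left (by nlinarith) (by positivity)
      have h3 : 0 ≤ |T| * M ^ 2 + (|T| + 1) * M := by positivity
      nlinarith
    · have h0 : 0 ≤ c * y ^ 3 := by positivity
      have h1 : |T| * y ^ 2 + (|T| + 1) * y ≤ |T| * M ^ 2 + (|T| + 1) * M := by gcongr
      linarith
  have e1 : -|T| * y ^ 2 ≤ s * y ^ 2 := mul_le_mul_of_nonneg_right hs'.1 (sq_nonneg y)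
  have e2 : s * y ≤ |T| * y := mul_le_mul_of_nonneg_right hs'.2 hy0
  linarith

lemma weight_nonneg (σ c t x : ℝ) : 0 ≤ weight σ c t x := by
  unfold weight; positivity

lemma continuous_weight {σ : ℝ} (hσ : 0 < σ) (c t : ℝ) : Continuous (weight σ c t) := by
  unfold weight
  refine Continuous.mul ?_ (by fun_prop)
  exact continuous_abs.rpow_const fun x => Or.inr (by linarith)

/-- An integrable bound of `|x|^k W(x; s)`, uniform for `s` in a bounded set. -/
lemma exists_bound_pow_mul_weight {σ c : ℝ} (hσ : 0 < σ) (hc : 0 < c) (T : ℝ) (k : ℕ) :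
    ∃ B : ℝ → ℝ, Integrable B ∧ ∀ s, |s| ≤ T → ∀ x, |x| ^ k * weight σ c s x ≤ B x := by
  obtain ⟨C, hC⟩ := exp_neg_sextic_le hc T
  obtain ⟨N, hN⟩ := exists_nat_ge (2 * σ + 1)
  refine ⟨fun x => C * (|x| ^ k * Real.exp (-x ^ 2) + |x| ^ (k + N) * Real.exp (-x ^ 2)),
    ((integrable_abs_pow_mul_exp_neg_sq k).add
      (integrable_abs_pow_mul_exp_neg_sq (k + N))).const_mul C, fun s hs x => ?_⟩
  have h1 : |x| ^ (2 * σ + 1) ≤ 1 + |x| ^ N := by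
    rcases le_total |x| 1 with h | h
    · have := Real.rpow_le_one (abs_nonneg x) h (by linarith : 0 ≤ 2 * σ + 1)
      have : 0 ≤ |x| ^ N := by positivity
      linarith
    · have := Real.rpow_le_rpow_of_exponent_le h hN
      rw [Real.rpow_natCast] at this
      linarith
  have h2 := hC s hs x
  calc |x| ^ k * weight σ c s x
      ≤ |x| ^ k * ((1 + |x| ^ N) * (C * Real.exp (-x ^ 2))) := by
        unfold weight
        gcongr
    _ = _ := by ring

/-! ### The moment functional: positivity, symmetry, derivatives -/

lemma integrable_eval_mul_weight {σ c : ℝ} (hσ : 0 < σ) (hc : 0 < c) (t : ℝ) (p : ℝ[X]) :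
    Integrable fun x => p.eval x * weight σ c t x := by
  induction p using Polynomial.induction_on' with
  | add p q hp hq => simpa only [eval_add, add_mul] using! hp.add hq
  | monomial k a =>
    obtain ⟨B, hB, hle⟩ := exists_bound_pow_mul_weight hσ hc |t| k
    have : Integrable fun x => x ^ k * weight σ c t x := by
      refine hB.mono' (((continuous_pow k).mul (continuous_weight hσ c t)).aestronglyMeasurable)
        (Filter.Eventually.of_forall fun x => ?_)
      rw [norm_mul, norm_pow, Real.norm_eq_abs, Real.norm_of_nonneg (weight_nonneg _ _ _ _)]
      exact hle t le_rfl x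
    simpa [mul_assoc] using this.const_mul a

/-- The moment functional `p ↦ ∫ p(x) W(x; t) dx`. -/
noncomputable def momentFunctional {σ c : ℝ} (hσ : 0 < σ) (hc : 0 < c) (t : ℝ) : ℝ[X] →ₗ[ℝ] ℝ where
  toFun p := ∫ x, p.eval x * weight σ c t x
  map_add' p q := by
    simp only [eval_add, add_mul]
    exact integral_add (integrable_eval_mul_weight hσ hc t p) (integrable_eval_mul_weight hσ hc t q)
  map_smul' a p := by
    simp only [eval_smul, smul_eq_mul, mul_assoc, RingHom.id_apply]
    exact integral_const_mul _ _

lemma innerW_eq_momentFunctional {σ c : ℝ} (hσ : 0 < σ) (hc : 0 < c) (t : ℝ) (p q : ℝ[X]) :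
    innerW σ c t p q = momentFunctional hσ hc t (p * q) := by
  simp [innerW, momentFunctional]

lemma momentFunctional_mul_self_pos {σ c : ℝ} (hσ : 0 < σ) (hc : 0 < c) (t : ℝ) {p : ℝ[X]}
    (hp : p ≠ 0) : 0 < momentFunctional hσ hc t (p * p) := by
  have hcont : Continuous fun x => (p * p).eval x * weight σ c t x :=
    (p * p).continuous.mul (continuous_weight hσ c t)
  -- The weight vanishes at 0, so a nonzero point where p does not vanish is required; the factor
  -- `X` excludes 0.
  obtain ⟨x, hx⟩ : ∃ x, (p * X).eval x ≠ 0 := by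
    by_contra! h
    exact mul_ne_zero hp X_ne_zero (Polynomial.funext fun x => by simpa using h x)
  simp only [eval_mul, eval_X, ne_eq, mul_eq_zero, not_or] at hx
  refine integral_pos_of_integrable_nonneg_nonzero hcont
    (integrable_eval_mul_weight hσ hc t (p * p)) (fun y => ?_) (x := x) ?_
  · rw [eval_mul]
    exact mul_nonneg (mul_self_nonneg _) (weight_nonneg _ _ _ _)
  · have hw : weight σ c t x ≠ 0 :=
      (mul_pos (Real.rpow_pos_of_pos (abs_pos.mpr hx.2) _) (Real.exp_pos _)).ne'
    simpa using ⟨hx.1, hw⟩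

lemma momentFunctional_comp_neg_X {σ c : ℝ} (hσ : 0 < σ) (hc : 0 < c) (t : ℝ) (p : ℝ[X]) :
    momentFunctional hσ hc t (p.comp (-X)) = momentFunctional hσ hc t p := by
  change ∫ x, (p.comp (-X)).eval x * weight σ c t x = ∫ x, p.eval x * weight σ c t x
  rw [← integral_neg_eq_self fun x => p.eval x * weight σ c t x]
  congr 1
  ext x
  simp [weight, Even.neg_pow (show Even 6 by decide), Even.neg_pow (show Even 4 by decide)]

lemma hasDerivAt_weight_param (σ c t x : ℝ) :
    HasDerivAt (fun s => weight σ c s x) (-((x ^ 4 - x ^ 2) * weight σ c t x)) t := by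
  unfold weight
  have h := ((((hasDerivAt_id t).mul_const (x ^ 4 - x ^ 2)).const_add (c * x ^ 6)).neg.exp).const_mul
    (|x| ^ (2 * σ + 1))
  refine h.congr_deriv ?_
  simp only [id, Pi.neg_apply]
  ring

lemma hasDerivAt_weight {σ : ℝ} (hσ : 0 < σ) (c t x : ℝ) :
    HasDerivAt (weight σ c t)
      ((2 * σ + 1) * |x| ^ (2 * σ + 1 - 2) * x * Real.exp (-(c * x ^ 6 + t * (x ^ 4 - x ^ 2))) -
        (6 * c * x ^ 5 + 4 * t * x ^ 3 - 2 * t * x) * weight σ c t x) x := by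
  have h1 := hasDerivAt_abs_rpow x (by linarith : 1 < 2 * σ + 1)
  have h2 := (((hasDerivAt_pow 6 x).const_mul c).add
    (((hasDerivAt_pow 4 x).sub (hasDerivAt_pow 2 x)).const_mul t)).neg.exp
  refine (h1.mul h2).congr_deriv ?_
  simp only [weight, Pi.add_apply, Pi.sub_apply, Pi.neg_apply]
  push_cast
  ring

lemma hasDerivAt_momentFunctional {σ c : ℝ} (hσ : 0 < σ) (hc : 0 < c) (t : ℝ) (p : ℝ[X]) :
    HasDerivAt (fun s => momentFunctional hσ hc s p)
      (-momentFunctional hσ hc t ((X ^ 4 - X ^ 2) * p)) t := by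
  induction p using Polynomial.induction_on' with
  | add p q hp hq =>
    simp only [mul_add, map_add]
    exact (hp.add hq).congr_deriv (by ring)
  | monomial k a =>
    -- The parameter ranges over the unit ball around t, hence |s| ≤ |t| + 1.
    obtain ⟨B, hB, hle⟩ := exists_bound_pow_mul_weight hσ hc (|t| + 1) (k + 4)
    obtain ⟨B', hB', hle'⟩ := exists_bound_pow_mul_weight hσ hc (|t| + 1) (k + 2)
    have h := (hasDerivAt_integral_of_dominated_loc_of_deriv_le (μ := volume) (x₀ := t)
      (F := fun s x => (monomial k a).eval x * weight σ c s x)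
      (F' := fun s x => (monomial k a).eval x * -((x ^ 4 - x ^ 2) * weight σ c s x))
      (bound := fun x => |a| * (B x + B' x))
      (Metric.ball_mem_nhds t one_pos)
      (Filter.Eventually.of_forall fun s =>
        (integrable_eval_mul_weight hσ hc s _).aestronglyMeasurable)
      (integrable_eval_mul_weight hσ hc t _) ?_ ?_ ((hB.add hB').const_mul _) ?_).2
    · refine h.congr_deriv ?_
      change _ = -∫ x, ((X ^ 4 - X ^ 2) * monomial k a).eval x * weight σ c t x
      rw [← integral_neg]
      congr 1
      ext x
      simp only [eval_mul, eval_sub, eval_pow, eval_X]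
      ring
    · have := continuous_weight hσ c t
      exact Continuous.aestronglyMeasurable (by fun_prop)
    · refine Filter.Eventually.of_forall fun x s hs => ?_
      have hs' : |s| ≤ |t| + 1 := by
        rw [Metric.mem_ball, Real.dist_eq] at hs
        have := abs_add_le (s - t) t
        rw [sub_add_cancel] at this
        linarith
      have h1 := hle s hs' x
      have h2 := hle' s hs' x
      have hw := weight_nonneg σ c s x
      have h3 : |x ^ 4 - x ^ 2| ≤ |x| ^ 4 + |x| ^ 2 := by
        rw [← abs_pow, ← abs_pow]
        exact abs_sub _ _
      rw [eval_monomial, norm_mul, norm_mul, norm_neg, norm_mul, norm_pow, Real.norm_eq_abs,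
        Real.norm_eq_abs, Real.norm_eq_abs, Real.norm_of_nonneg hw]
      calc |a| * |x| ^ k * (|x ^ 4 - x ^ 2| * weight σ c s x)
          ≤ |a| * |x| ^ k * ((|x| ^ 4 + |x| ^ 2) * weight σ c s x) := by gcongr
        _ = |a| * (|x| ^ (k + 4) * weight σ c s x + |x| ^ (k + 2) * weight σ c s x) := by ring
        _ ≤ |a| * (B x + B' x) := by gcongr
    · exact Filter.Eventually.of_forall fun x s _ =>
        (hasDerivAt_weight_param σ c s x).const_mul _

/-- Integration by parts: x p W has an integrable derivative and is itself integrable, so the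
integral of the derivative is 0. The factor x cancels the pole (2σ+1)/x of W'/W, which keeps every
integrand a polynomial times W. -/
lemma momentFunctional_derivative_X_mul {σ c : ℝ} (hσ : 0 < σ) (hc : 0 < c) (t : ℝ) (p : ℝ[X]) :
    momentFunctional hσ hc t (derivative (X * p)) + (2 * σ + 1) * momentFunctional hσ hc t p =
      momentFunctional hσ hc t
        ((C (6 * c) * X ^ 5 + C (4 * t) * X ^ 3 - C (2 * t) * X) * (X * p)) := by
  set q : ℝ[X] := derivative (X * p) + (2 * σ + 1) • p -
    (C (6 * c) * X ^ 5 + C (4 * t) * X ^ 3 - C (2 * t) * X) * (X * p) with hq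
  suffices h : momentFunctional hσ hc t q = 0 by
    rw [hq, map_sub, map_add, map_smul, smul_eq_mul] at h
    linarith
  refine integral_eq_zero_of_hasDerivAt_of_integrable
    (f := fun x => (X * p).eval x * weight σ c t x) (fun x => ?_)
    (integrable_eval_mul_weight hσ hc t q) (integrable_eval_mul_weight hσ hc t _)
  refine (((X * p).hasDerivAt x).mul (hasDerivAt_weight hσ c t x)).congr_deriv ?_
  have habs : |x| ^ (2 * σ + 1 - 2) * x * x = |x| ^ (2 * σ + 1) := by
    rcases eq_or_ne x 0 with rfl | hx
    · rw [abs_zero, Real.zero_rpow (show 2 * σ + 1 ≠ 0 by linarith), mul_zero]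
    · rw [mul_assoc, ← abs_mul_abs_self x, ← pow_two, ← Real.rpow_natCast,
        ← Real.rpow_add (abs_pos.mpr hx)]
      norm_num
  simp only [hq, eval_add, eval_sub, eval_mul, eval_smul, eval_C, eval_pow, eval_X, smul_eq_mul]
  have hw : weight σ c t x = |x| ^ (2 * σ + 1) *
    Real.exp (-(c * x ^ 6 + t * (x ^ 4 - x ^ 2))) := rfl
  linear_combination ((2 * σ + 1) * p.eval x * Real.exp (-(c * x ^ 6 + t * (x ^ 4 - x ^ 2)))) *
    habs - (2 * σ + 1) * p.eval x * hw

/-! ### Orthogonality and uniqueness of the monic polynomials -/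

lemma degree_C_mul_le_degree (a : ℝ) (p : ℝ[X]) : (C a * p).degree ≤ p.degree := by
  rw [← smul_eq_C_mul]
  exact degree_smul_le a p

lemma orthoPoly_monic_and_natDegree (σ c t : ℝ) (n : ℕ) :
    (orthoPoly σ c t n).Monic ∧ (orthoPoly σ c t n).natDegree = n := by
  induction n using Nat.strong_induction_on with
  | _ n ih =>
    rw [orthoPoly]
    have hdeg : (∑ k : Fin n, C (innerW σ c t (X ^ n) (orthoPoly σ c t k) /
        innerW σ c t (orthoPoly σ c t k) (orthoPoly σ c t k)) * orthoPoly σ c t k).degree < n := by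
      refine (degree_sum_le _ _).trans_lt ?_
      refine (Finset.sup_lt_iff (WithBot.bot_lt_coe n)).mpr fun k _ => ?_
      refine (degree_C_mul_le_degree _ _).trans_lt (degree_le_natDegree.trans_lt ?_)
      rw [(ih k k.isLt).2]
      exact Nat.cast_lt.mpr k.isLt
    refine ⟨monic_X_pow_sub hdeg, natDegree_eq_of_degree_eq_some ?_⟩
    rw [degree_sub_eq_left_of_degree_lt (by simpa using hdeg), degree_X_pow]

lemma orthoPoly_monic (σ c t : ℝ) (n : ℕ) : (orthoPoly σ c t n).Monic :=
  (orthoPoly_monic_and_natDegree σ c t n).1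

lemma natDegree_orthoPoly (σ c t : ℝ) (n : ℕ) : (orthoPoly σ c t n).natDegree = n :=
  (orthoPoly_monic_and_natDegree σ c t n).2

lemma degree_orthoPoly (σ c t : ℝ) (n : ℕ) : (orthoPoly σ c t n).degree = n := by
  rw [degree_eq_natDegree (orthoPoly_monic σ c t n).ne_zero, natDegree_orthoPoly]

section OrthogonalPolynomials

variable {σ c : ℝ} (hσ : 0 < σ) (hc : 0 < c) (t : ℝ)

/-- The squared norm `⟨S_n, S_n⟩`. -/
noncomputable def sqNorm (n : ℕ) : ℝ := momentFunctional hσ hc t (orthoPoly σ c t n * orthoPoly σ c t n)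

lemma sqNorm_pos (n : ℕ) : 0 < sqNorm hσ hc t n :=
  momentFunctional_mul_self_pos hσ hc t (orthoPoly_monic σ c t n).ne_zero

lemma momentFunctional_orthoPoly_mul_of_lt (n : ℕ) : ∀ k < n,
    momentFunctional hσ hc t (orthoPoly σ c t n * orthoPoly σ c t k) = 0 := by
  induction n using Nat.strong_induction_on with
  | _ n ih =>
    intro k hk
    have hne := (sqNorm_pos hσ hc t k).ne'
    rw [orthoPoly, sub_mul, map_sub, Finset.sum_mul, map_sum,
      Finset.sum_eq_single (⟨k, hk⟩ : Fin n)]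
    · rw [mul_assoc, ← smul_eq_C_mul, map_smul, smul_eq_mul, innerW_eq_momentFunctional hσ hc,
        innerW_eq_momentFunctional hσ hc]
      exact sub_eq_zero.mpr (div_mul_cancel₀ _ hne).symm
    · intro j _ hj
      have hjk : (j : ℕ) ≠ k := fun h => hj (Fin.ext h)
      rw [mul_assoc, ← smul_eq_C_mul, map_smul, smul_eq_mul]
      rcases lt_or_gt_of_ne hjk with h | h
      · rw [mul_comm (orthoPoly σ c t j), ih k hk j h, mul_zero]
      · rw [ih j j.isLt k h, mul_zero]
    · simp

lemma degree_sub_C_mul_orthoPoly_lt {n : ℕ} {q : ℝ[X]} (hq : q.degree < (n + 1 : ℕ)) :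
    (q - C (q.coeff n) * orthoPoly σ c t n).degree < n := by
  rw [degree_lt_iff_coeff_zero] at hq ⊢
  intro m hm
  rcases hm.eq_or_lt with rfl | hm
  · have := (orthoPoly_monic σ c t n).coeff_natDegree
    rw [natDegree_orthoPoly] at this
    simp [this]
  · rw [coeff_sub, coeff_C_mul, hq m hm,
      coeff_eq_zero_of_natDegree_lt (p := orthoPoly σ c t n) (by rwa [natDegree_orthoPoly]),
      mul_zero, sub_zero]

lemma momentFunctional_mul_eq_zero_of_degree_lt (P : ℝ[X]) (n : ℕ)
    (h : ∀ k < n, momentFunctional hσ hc t (P * orthoPoly σ c t k) = 0) (q : ℝ[X])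
    (hq : q.degree < n) : momentFunctional hσ hc t (P * q) = 0 := by
  induction n generalizing q with
  | zero =>
    have : q = 0 := by
      ext m
      simpa using (degree_lt_iff_coeff_zero _ _).mp hq m
    simp [this]
  | succ n ih =>
    have h0 := ih (fun k hk => h k (by lia)) _ (degree_sub_C_mul_orthoPoly_lt (σ := σ) (c := c) t hq)
    rw [mul_sub, map_sub, mul_left_comm, ← smul_eq_C_mul, map_smul, h n (by lia), smul_zero,
      sub_zero] at h0
    exact h0

lemma momentFunctional_orthoPoly_mul_eq_zero {n : ℕ} {q : ℝ[X]} (hq : q.degree < n) :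
    momentFunctional hσ hc t (orthoPoly σ c t n * q) = 0 :=
  momentFunctional_mul_eq_zero_of_degree_lt hσ hc t _ n
    (momentFunctional_orthoPoly_mul_of_lt hσ hc t n) q hq

lemma momentFunctional_orthoPoly_mul_orthoPoly (m n : ℕ) :
    momentFunctional hσ hc t (orthoPoly σ c t m * orthoPoly σ c t n) =
      if m = n then sqNorm hσ hc t m else 0 := by
  split_ifs with h
  · subst h; rfl
  · rcases lt_or_gt_of_ne h with h | h
    · rw [mul_comm, momentFunctional_orthoPoly_mul_of_lt hσ hc t _ _ h]
    · rw [momentFunctional_orthoPoly_mul_of_lt hσ hc t _ _ h]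

lemma momentFunctional_orthoPoly_mul_eq_coeff_mul {n : ℕ} {q : ℝ[X]}
    (hq : q.degree < (n + 1 : ℕ)) :
    momentFunctional hσ hc t (orthoPoly σ c t n * q) = q.coeff n * sqNorm hσ hc t n := by
  have h := momentFunctional_orthoPoly_mul_eq_zero hσ hc t
    (degree_sub_C_mul_orthoPoly_lt (σ := σ) (c := c) t hq)
  rw [mul_sub, map_sub, sub_eq_zero, mul_left_comm, ← smul_eq_C_mul, map_smul] at h
  exact h

lemma momentFunctional_orthoPoly_mul_monic {n : ℕ} {p : ℝ[X]} (hp : p.Monic)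
    (hn : p.natDegree = n) :
    momentFunctional hσ hc t (orthoPoly σ c t n * p) = sqNorm hσ hc t n := by
  rw [momentFunctional_orthoPoly_mul_eq_coeff_mul, ← hn, hp.coeff_natDegree, one_mul]
  rw [degree_eq_natDegree hp.ne_zero, hn]
  exact Nat.cast_lt.mpr n.lt_succ_self

include hσ hc in
-- The difference of two monic candidates has degree below n, so it is orthogonal to both and hence
-- to itself; positivity makes it 0. Parity and the recurrence both follow from this uniqueness.
lemma eq_orthoPoly {n : ℕ} {p : ℝ[X]} (hp : p.Monic) (hn : p.natDegree = n)
    (h : ∀ k < n, momentFunctional hσ hc t (p * orthoPoly σ c t k) = 0) :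
    p = orthoPoly σ c t n := by
  have hd : (p - orthoPoly σ c t n).degree < n := by
    have := degree_sub_lt_left (p := p) (q := orthoPoly σ c t n)
      (by rw [degree_orthoPoly, degree_eq_natDegree hp.ne_zero, hn]) hp.ne_zero
      (by rw [hp.leadingCoeff, (orthoPoly_monic σ c t n).leadingCoeff])
    rwa [degree_eq_natDegree hp.ne_zero, hn] at this
  by_contra hne
  have hpos := momentFunctional_mul_self_pos hσ hc t (sub_ne_zero.mpr hne)
  rw [sub_mul, map_sub, momentFunctional_mul_eq_zero_of_degree_lt hσ hc t p n h _ hd,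
    momentFunctional_orthoPoly_mul_eq_zero hσ hc t hd, sub_zero] at hpos
  exact hpos.false

/-! ### Parity and the three-term recurrence -/

include hσ hc in
lemma orthoPoly_comp_neg_X (n : ℕ) :
    (orthoPoly σ c t n).comp (-X) = C ((-1) ^ n) * orthoPoly σ c t n := by
  have hnd : ((orthoPoly σ c t n).comp (-X)).natDegree = n := by
    rw [natDegree_comp, natDegree_neg, natDegree_X, mul_one, natDegree_orthoPoly]
  have hlc : ((orthoPoly σ c t n).comp (-X)).leadingCoeff = (-1) ^ n := by
    rw [leadingCoeff_comp (by simp), (orthoPoly_monic σ c t n).leadingCoeff,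
      natDegree_orthoPoly]
    simp
  have hsq : ((-1 : ℝ) ^ n) * (-1) ^ n = 1 := by rw [← mul_pow]; norm_num
  have hne : (-1 : ℝ) ^ n ≠ 0 := by intro h; simp [h] at hsq
  have h := eq_orthoPoly hσ hc t (n := n) (p := C ((-1) ^ n) * (orthoPoly σ c t n).comp (-X))
    (by rw [Monic, leadingCoeff_mul, leadingCoeff_C, hlc, hsq])
    (by rw [natDegree_C_mul hne, hnd]) ?_
  · conv_rhs => rw [← h, ← mul_assoc, ← C_mul, hsq, C_1, one_mul]
  · intro k hk
    have hcomp : (orthoPoly σ c t n).comp (-X) * orthoPoly σ c t k =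
        (orthoPoly σ c t n * (orthoPoly σ c t k).comp (-X)).comp (-X) := by
      rw [mul_comp, comp_assoc]; simp
    rw [mul_assoc, ← smul_eq_C_mul, map_smul, hcomp, momentFunctional_comp_neg_X,
      momentFunctional_orthoPoly_mul_eq_zero, smul_zero]
    refine degree_le_natDegree.trans_lt ?_
    rw [natDegree_comp, natDegree_neg, natDegree_X, mul_one, natDegree_orthoPoly]
    exact_mod_cast hk

lemma momentFunctional_eq_zero_of_comp_neg_X {p : ℝ[X]} (hp : p.comp (-X) = -p) :
    momentFunctional hσ hc t p = 0 := by
  have h := momentFunctional_comp_neg_X hσ hc t p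
  rw [hp, map_neg] at h
  linarith

lemma gam_zero (σ c t : ℝ) : gam σ c 0 t = 0 := rfl

lemma gam_of_nonpos (σ c t : ℝ) {k : ℤ} (hk : k ≤ 0) : gam σ c k t = 0 := by
  rcases k with (_ | k) | k
  · rfl
  · simp at hk; lia
  · rfl

lemma momentFunctional_X_mul_orthoPoly (n : ℕ) :
    momentFunctional hσ hc t (X * orthoPoly σ c t (n + 1) * orthoPoly σ c t n) =
      sqNorm hσ hc t (n + 1) := by
  rw [mul_comm X, mul_assoc]
  exact momentFunctional_orthoPoly_mul_monic hσ hc t (monic_X.mul (orthoPoly_monic σ c t n))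
    (by rw [monic_X.natDegree_mul (orthoPoly_monic σ c t n), natDegree_X, natDegree_orthoPoly,
      add_comm])

/-- Since x S_n is monic of degree n + 1, its product with S_{n+1} integrates to h_{n+1}. -/
lemma gam_add_one (n : ℕ) :
    gam σ c (n + 1) t = sqNorm hσ hc t (n + 1) / sqNorm hσ hc t n := by
  rw [← momentFunctional_X_mul_orthoPoly, sqNorm, ← innerW_eq_momentFunctional,
    ← innerW_eq_momentFunctional]
  rfl

lemma sqNorm_add_one (n : ℕ) :
    sqNorm hσ hc t (n + 1) = gam σ c (n + 1) t * sqNorm hσ hc t n := by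
  rw [gam_add_one hσ hc, div_mul_cancel₀ _ (sqNorm_pos hσ hc t n).ne']

lemma momentFunctional_X_mul_orthoPoly_mul_self (n : ℕ) :
    momentFunctional hσ hc t (X * orthoPoly σ c t n * orthoPoly σ c t n) = 0 := by
  apply momentFunctional_eq_zero_of_comp_neg_X
  have hsq : C ((-1 : ℝ) ^ n) * C ((-1) ^ n) = 1 := by
    rw [← C_mul, ← mul_pow]; norm_num
  simp only [mul_comp, X_comp, orthoPoly_comp_neg_X hσ hc]
  linear_combination (-X * orthoPoly σ c t n * orthoPoly σ c t n) * hsq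

include hσ hc in
lemma X_mul_orthoPoly_zero : X * orthoPoly σ c t 0 = orthoPoly σ c t 1 := by
  refine eq_orthoPoly hσ hc t (monic_X.mul (orthoPoly_monic σ c t 0)) ?_ fun k hk => ?_
  · rw [monic_X.natDegree_mul (orthoPoly_monic σ c t 0), natDegree_X, natDegree_orthoPoly]
  · obtain rfl : k = 0 := by lia
    exact momentFunctional_X_mul_orthoPoly_mul_self hσ hc t 0

include hσ hc in
/-- The three-term recurrence. -/
lemma X_mul_orthoPoly_add_one (n : ℕ) :
    X * orthoPoly σ c t (n + 1) =
      orthoPoly σ c t (n + 2) + C (gam σ c (n + 1) t) * orthoPoly σ c t n := by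
  rw [← sub_eq_iff_eq_add]
  have hm := monic_X.mul (orthoPoly_monic σ c t (n + 1))
  have hnd : (X * orthoPoly σ c t (n + 1)).natDegree = n + 2 := by
    rw [monic_X.natDegree_mul (orthoPoly_monic σ c t (n + 1)), natDegree_X, natDegree_orthoPoly]
    ring
  have hdeg : (C (gam σ c (n + 1) t) * orthoPoly σ c t n).degree <
      (X * orthoPoly σ c t (n + 1)).degree := by
    refine (degree_C_mul_le_degree _ _).trans_lt ?_
    rw [degree_orthoPoly, degree_eq_natDegree hm.ne_zero, hnd]
    exact_mod_cast (by lia : n < n + 2)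
  refine eq_orthoPoly hσ hc t (hm.sub_of_left hdeg) ?_ fun k hk => ?_
  · rw [natDegree_eq_of_degree_eq (degree_sub_eq_left_of_degree_lt hdeg), hnd]
  · rw [sub_mul, map_sub, mul_assoc (C _), ← smul_eq_C_mul, map_smul,
      momentFunctional_orthoPoly_mul_orthoPoly]
    -- Three cases: k < n by degree, k = n by the value of γ_{n+1}, k = n + 1 by parity.
    rcases Nat.lt_succ_iff_lt_or_eq.mp hk with hk | rfl
    · rcases Nat.lt_succ_iff_lt_or_eq.mp hk with hk | rfl
      · rw [if_neg (by lia), mul_comm X, mul_assoc, momentFunctional_orthoPoly_mul_eq_zero]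
        · simp
        · rw [degree_mul, degree_X, degree_orthoPoly]
          exact_mod_cast (by lia : 1 + k < n + 1)
      · rw [if_pos rfl, momentFunctional_X_mul_orthoPoly, smul_eq_mul, sqNorm_add_one, sub_self]
    · rw [if_neg (by lia), momentFunctional_X_mul_orthoPoly_mul_self]
      simp

/-! ### Moments of S_{n+1} S_n in terms of the recurrence coefficients -/

/-- The inner product as a bilinear form. -/
noncomputable def momentForm : ℝ[X] →ₗ[ℝ] ℝ[X] →ₗ[ℝ] ℝ :=
  (LinearMap.mul ℝ ℝ[X]).compr₂ (momentFunctional hσ hc t)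

lemma momentForm_apply (p q : ℝ[X]) :
    momentForm hσ hc t p q = momentFunctional hσ hc t (p * q) := rfl

lemma momentForm_orthoPoly (m n : ℕ) :
    momentForm hσ hc t (orthoPoly σ c t m) (orthoPoly σ c t n) =
      if m = n then sqNorm hσ hc t m else 0 :=
  momentFunctional_orthoPoly_mul_orthoPoly hσ hc t m n

include hσ hc in
-- Indices 0 and 1 are separate because the general expansion of x² S_n involves S_{n-2}.
lemma X_sq_mul_orthoPoly_zero : X ^ 2 * orthoPoly σ c t 0 =
    orthoPoly σ c t 2 + gam σ c 1 t • orthoPoly σ c t 0 := by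
  have h1 := X_mul_orthoPoly_zero hσ hc t
  have h2 := X_mul_orthoPoly_add_one hσ hc t 0
  norm_num at h1 h2
  rw [smul_eq_C_mul]
  linear_combination X * h1 + h2

include hσ hc in
lemma X_sq_mul_orthoPoly_one : X ^ 2 * orthoPoly σ c t 1 =
    orthoPoly σ c t 3 + (gam σ c 1 t + gam σ c 2 t) • orthoPoly σ c t 1 := by
  have h1 := X_mul_orthoPoly_zero hσ hc t
  have h2 := X_mul_orthoPoly_add_one hσ hc t 0
  have h3 := X_mul_orthoPoly_add_one hσ hc t 1
  norm_num at h1 h2 h3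
  rw [smul_eq_C_mul, C_add]
  linear_combination X * h2 + h3 + C (gam σ c 1 t) * h1

include hσ hc in
lemma X_sq_mul_orthoPoly_add_two (n : ℕ) : X ^ 2 * orthoPoly σ c t (n + 2) =
    orthoPoly σ c t (n + 4) + (gam σ c (n + 2) t + gam σ c (n + 3) t) • orthoPoly σ c t (n + 2) +
      (gam σ c (n + 2) t * gam σ c (n + 1) t) • orthoPoly σ c t n := by
  have h1 := X_mul_orthoPoly_add_one hσ hc t n
  have h2 := X_mul_orthoPoly_add_one hσ hc t (n + 1)
  have h3 := X_mul_orthoPoly_add_one hσ hc t (n + 2)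
  push_cast at h1 h2 h3
  norm_num [add_assoc] at h1 h2 h3
  simp only [smul_eq_C_mul, C_add, C_mul]
  linear_combination X * h2 + h3 + C (gam σ c (n + 2) t) * h1

lemma sqNorm_eq_gam_mul (n : ℕ) :
    sqNorm hσ hc t (n + 2) = gam σ c (n + 2) t * sqNorm hσ hc t (n + 1) := by
  have := sqNorm_add_one hσ hc t (n + 1)
  push_cast at this
  rwa [add_assoc, add_assoc, one_add_one_eq_two] at this

lemma momentForm_X_sq (n : ℕ) :
    momentForm hσ hc t (X ^ 2 * orthoPoly σ c t n) (orthoPoly σ c t n) =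
      (gam σ c n t + gam σ c (n + 1) t) * sqNorm hσ hc t n := by
  rcases n with _ | _ | n
  · rw [X_sq_mul_orthoPoly_zero hσ hc]
    simp [momentForm_orthoPoly, gam_zero]
  · rw [zero_add, X_sq_mul_orthoPoly_one hσ hc]
    simp [momentForm_orthoPoly, one_add_one_eq_two]
  · rw [add_assoc, X_sq_mul_orthoPoly_add_two hσ hc]
    simp [momentForm_orthoPoly, add_assoc]

lemma momentForm_X_sq_X_sq (n : ℕ) :
    momentForm hσ hc t (X ^ 2 * orthoPoly σ c t n) (X ^ 2 * orthoPoly σ c t n) =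
      (Xi σ c n t + Xi σ c (n + 1) t) * sqNorm hσ hc t n := by
  have h1 := sqNorm_add_one hσ hc t
  have h2 := sqNorm_eq_gam_mul hσ hc t
  rcases n with _ | _ | n
  · have e1 := h1 0
    have e2 := h2 0
    rw [X_sq_mul_orthoPoly_zero hσ hc]
    simp [momentForm_orthoPoly, Xi, gam_zero, one_add_one_eq_two] at e1 e2 ⊢
    rw [e2, e1]
    ring
  · have e1 := h1 0
    have e2 := h2 0
    have e3 := h2 1
    rw [zero_add, X_sq_mul_orthoPoly_one hσ hc]
    norm_num [momentForm_orthoPoly, Xi, gam_zero] at e1 e2 e3 ⊢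
    rw [e3, e2]
    ring
  · have e1 := h1 n
    have e2 := h2 n
    have e3 := h2 (n + 1)
    have e4 := h2 (n + 2)
    have i1 : (n : ℤ) + 2 - 1 = n + 1 := by ring
    have i2 : (n : ℤ) + 3 - 1 = n + 2 := by ring
    rw [add_assoc, one_add_one_eq_two, X_sq_mul_orthoPoly_add_two hσ hc]
    norm_num [momentForm_orthoPoly, Xi, add_assoc, i1, i2] at e1 e2 e3 e4 ⊢
    rw [e4, e3, e2, e1]
    ring

/-- Expanding both factors in the S_k leaves only the shared indices n + 2 and n. This is the
off-diagonal part of the fifth moment. -/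
lemma momentForm_X_sq_add_two_X_sq (n : ℕ) :
    momentForm hσ hc t (X ^ 2 * orthoPoly σ c t (n + 2)) (X ^ 2 * orthoPoly σ c t n) =
      gam σ c (n + 2) t * gam σ c (n + 1) t * (gam σ c n t + gam σ c (n + 1) t + gam σ c (n + 2) t
        + gam σ c (n + 3) t) * sqNorm hσ hc t n := by
  have h1 := sqNorm_add_one hσ hc t
  have h2 := sqNorm_eq_gam_mul hσ hc t
  rw [X_sq_mul_orthoPoly_add_two hσ hc]
  rcases n with _ | _ | n
  · have e1 := h1 0
    have e2 := h2 0
    rw [X_sq_mul_orthoPoly_zero hσ hc]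
    norm_num [momentForm_orthoPoly, gam_zero] at e1 e2 ⊢
    rw [e2, e1]
    ring
  · have e2 := h2 0
    have e3 := h2 1
    rw [zero_add, X_sq_mul_orthoPoly_one hσ hc]
    norm_num [momentForm_orthoPoly] at e2 e3 ⊢
    rw [e3, e2]
    ring
  · have e3 := h2 (n + 1)
    have e4 := h2 (n + 2)
    rw [add_assoc n, one_add_one_eq_two, X_sq_mul_orthoPoly_add_two hσ hc]
    norm_num [momentForm_orthoPoly, add_assoc] at e3 e4 ⊢
    rw [e4, e3]
    ring

/-- `⟨x^3 S_{n+1}, S_n⟩` in terms of the recurrence coefficients. -/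
lemma momentFunctional_X_pow_three (n : ℕ) :
    momentFunctional hσ hc t (X ^ 3 * (orthoPoly σ c t (n + 1) * orthoPoly σ c t n)) =
      Xi σ c (n + 1) t * sqNorm hσ hc t n := by
  have hX := X_mul_orthoPoly_add_one hσ hc t n
  have e1 := sqNorm_add_one hσ hc t n
  have e2 := sqNorm_eq_gam_mul hσ hc t n
  have hself := momentForm_X_sq hσ hc t n
  have hnext : momentForm hσ hc t (X ^ 2 * orthoPoly σ c t n) (orthoPoly σ c t (n + 2)) =
      sqNorm hσ hc t (n + 2) := by
    rw [momentForm_apply, mul_comm]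
    refine momentFunctional_orthoPoly_mul_monic hσ hc t
      ((monic_X_pow 2).mul (orthoPoly_monic σ c t n)) ?_
    rw [(monic_X_pow 2).natDegree_mul (orthoPoly_monic σ c t n), natDegree_X_pow,
      natDegree_orthoPoly, add_comm]
  have hrw : X ^ 3 * (orthoPoly σ c t (n + 1) * orthoPoly σ c t n) =
      X ^ 2 * orthoPoly σ c t n *
        (orthoPoly σ c t (n + 2) + gam σ c (n + 1) t • orthoPoly σ c t n) := by
    rw [smul_eq_C_mul, ← hX]
    ring
  rw [hrw, ← momentForm_apply, map_add, map_smul, hnext, hself, e2, e1, Xi, add_sub_cancel_right,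
    smul_eq_mul, add_assoc (n : ℤ), one_add_one_eq_two]
  ring

/-- `⟨x^5 S_{n+1}, S_n⟩` in terms of the recurrence coefficients. -/
lemma momentFunctional_X_pow_five (n : ℕ) :
    momentFunctional hσ hc t (X ^ 5 * (orthoPoly σ c t (n + 1) * orthoPoly σ c t n)) =
      gam σ c (n + 1) t * (gam σ c (n + 2) t * (gam σ c n t + gam σ c (n + 1) t +
        gam σ c (n + 2) t + gam σ c (n + 3) t) + Xi σ c n t + Xi σ c (n + 1) t) *
        sqNorm hσ hc t n := by
  have hX := X_mul_orthoPoly_add_one hσ hc t n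
  have hrw : X ^ 5 * (orthoPoly σ c t (n + 1) * orthoPoly σ c t n) =
      (X ^ 2 * orthoPoly σ c t (n + 2) + gam σ c (n + 1) t • (X ^ 2 * orthoPoly σ c t n)) *
        (X ^ 2 * orthoPoly σ c t n) := by
    rw [smul_eq_C_mul]
    linear_combination (X ^ 4 * orthoPoly σ c t n) * hX
  rw [hrw, ← momentForm_apply, map_add, map_smul, LinearMap.add_apply, LinearMap.smul_apply,
    momentForm_X_sq_add_two_X_sq, momentForm_X_sq_X_sq, smul_eq_mul]
  ring

lemma momentFunctional_X_pow_one (n : ℕ) :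
    momentFunctional hσ hc t (X * (orthoPoly σ c t (n + 1) * orthoPoly σ c t n)) =
      gam σ c (n + 1) t * sqNorm hσ hc t n := by
  rw [← mul_assoc, momentFunctional_X_mul_orthoPoly, sqNorm_add_one]

/-! ### The string equation -/

/-- Against S_n, only the leading coefficient n + 1 of S_{n+1}' counts; S_n' is orthogonal to
S_{n+1}. -/
lemma momentFunctional_derivative_mul (n : ℕ) :
    momentFunctional hσ hc t (derivative (orthoPoly σ c t (n + 1) * orthoPoly σ c t n)) =
      (n + 1) * sqNorm hσ hc t n := by
  have hlt : (derivative (orthoPoly σ c t (n + 1))).degree < (n + 1 : ℕ) := by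
    have := degree_derivative_lt (orthoPoly_monic σ c t (n + 1)).ne_zero
    rwa [degree_orthoPoly] at this
  have hlt' : (derivative (orthoPoly σ c t n)).degree < (n + 1 : ℕ) := by
    have := degree_derivative_lt (orthoPoly_monic σ c t n).ne_zero
    rw [degree_orthoPoly] at this
    exact this.trans (Nat.cast_lt.mpr n.lt_succ_self)
  have hcoeff := (orthoPoly_monic σ c t (n + 1)).coeff_natDegree
  rw [natDegree_orthoPoly] at hcoeff
  rw [derivative_mul, map_add, mul_comm (derivative _),
    momentFunctional_orthoPoly_mul_eq_coeff_mul hσ hc t hlt,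
    momentFunctional_orthoPoly_mul_eq_zero hσ hc t hlt', coeff_derivative, hcoeff]
  ring

include hσ hc in
lemma X_dvd_orthoPoly_of_odd {n : ℕ} (hn : Odd n) : X ∣ orthoPoly σ c t n := by
  have h := congrArg (eval 0) (orthoPoly_comp_neg_X hσ hc t n)
  rw [hn.neg_one_pow, eval_comp, eval_neg, eval_X, neg_zero, eval_mul, eval_C] at h
  rw [X_dvd_iff, coeff_zero_eq_eval_zero]
  linarith

/-- Source of Ω: exactly one factor has odd index, and x divides it. If it is S_{n+1}, the quotient
is monic of degree n and pairs with S_n to h_n; if it is S_n, the quotient has degree n - 1 and is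
orthogonal to S_{n+1}. -/
lemma exists_X_mul_eq_orthoPoly_mul (n : ℕ) :
    ∃ p, orthoPoly σ c t (n + 1) * orthoPoly σ c t n = X * p ∧
      momentFunctional hσ hc t p = Om (n + 1) * sqNorm hσ hc t n := by
  rcases Nat.even_or_odd n with hn | hn
  · obtain ⟨r, hr⟩ := X_dvd_orthoPoly_of_odd hσ hc t hn.add_one
    have hmon : r.Monic := monic_X.of_mul_monic_left (hr ▸ orthoPoly_monic σ c t (n + 1))
    have hdeg : r.natDegree = n := by
      have := natDegree_orthoPoly σ c t (n + 1)
      rw [hr, monic_X.natDegree_mul hmon, natDegree_X] at this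
      lia
    refine ⟨r * orthoPoly σ c t n, by rw [hr, mul_assoc], ?_⟩
    rw [mul_comm r, momentFunctional_orthoPoly_mul_monic hσ hc t hmon hdeg, Om,
      hn.add_one.neg_one_pow]
    ring
  · obtain ⟨r, hr⟩ := X_dvd_orthoPoly_of_odd hσ hc t hn
    have hmon : r.Monic := monic_X.of_mul_monic_left (hr ▸ orthoPoly_monic σ c t n)
    refine ⟨orthoPoly σ c t (n + 1) * r, by rw [hr, mul_left_comm], ?_⟩
    rw [momentFunctional_orthoPoly_mul_eq_zero, Om, hn.add_one.neg_one_pow]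
    · ring
    · have := natDegree_orthoPoly σ c t n
      rw [hr, monic_X.natDegree_mul hmon, natDegree_X] at this
      rw [degree_eq_natDegree hmon.ne_zero]
      exact Nat.cast_lt.mpr (by lia)

include hσ hc in
/-- The discrete string equation for the recurrence coefficients. -/
lemma string_equation (n : ℕ) :
    ((n : ℝ) + 1) + (2 * σ + 1) * Om (n + 1) =
      6 * c * (gam σ c (n + 1) t * (gam σ c (n + 2) t * (gam σ c n t + gam σ c (n + 1) t +
        gam σ c (n + 2) t + gam σ c (n + 3) t) + Xi σ c n t + Xi σ c (n + 1) t)) +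
        vartheta σ c (n + 1) t := by
  obtain ⟨p, hp, hpval⟩ := exists_X_mul_eq_orthoPoly_mul hσ hc t n
  have h := momentFunctional_derivative_X_mul hσ hc t p
  rw [← hp, momentFunctional_derivative_mul, hpval] at h
  simp only [add_mul, sub_mul, ← smul_eq_C_mul, smul_mul_assoc, map_add, map_sub, map_smul,
    momentFunctional_X_pow_one, momentFunctional_X_pow_three, momentFunctional_X_pow_five,
    smul_eq_mul] at h
  apply mul_right_cancel₀ (sqNorm_pos hσ hc t n).ne'
  rw [vartheta]
  linear_combination h

/-! ### Dependence on t and the Volterra equation -/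

/-- The uniform degree bound reduces this to the product rule on a finite sum of coefficients times
moments. -/
lemma hasDerivAt_momentFunctional_mul {P : ℝ → ℝ[X]} (Q : ℝ[X]) {N : ℕ}
    (hdeg : ∀ s, (P s).natDegree < N) {d : ℕ → ℝ}
    (hd : ∀ k, HasDerivAt (fun s => (P s).coeff k) (d k) t) :
    HasDerivAt (fun s => momentFunctional hσ hc s (P s * Q))
      (momentFunctional hσ hc t ((∑ k ∈ Finset.range N, monomial k (d k)) * Q) -
        momentFunctional hσ hc t ((X ^ 4 - X ^ 2) * (P t * Q))) t := by
  have hP : ∀ s u, momentFunctional hσ hc u (P s * Q) =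
      ∑ k ∈ Finset.range N, (P s).coeff k * momentFunctional hσ hc u (X ^ k * Q) := by
    intro s u
    conv_lhs => rw [(P s).as_sum_range' N (hdeg s)]
    simp only [← C_mul_X_pow_eq_monomial, ← smul_eq_C_mul, Finset.sum_mul, smul_mul_assoc,
      map_sum, map_smul, smul_eq_mul]
  have hR : momentFunctional hσ hc t ((X ^ 4 - X ^ 2) * (P t * Q)) =
      ∑ k ∈ Finset.range N, (P t).coeff k *
        momentFunctional hσ hc t ((X ^ 4 - X ^ 2) * (X ^ k * Q)) := by
    conv_lhs => rw [(P t).as_sum_range' N (hdeg t)]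
    simp only [← C_mul_X_pow_eq_monomial, ← smul_eq_C_mul, Finset.sum_mul, Finset.mul_sum,
      smul_mul_assoc, mul_smul_comm, map_sum, map_smul, smul_eq_mul]
  simp_rw [hP]
  refine (HasDerivAt.fun_sum fun k _ =>
    (hd k).mul (hasDerivAt_momentFunctional hσ hc t (X ^ k * Q))).congr_deriv ?_
  simp only [hR, mul_neg, ← sub_eq_add_neg, Finset.sum_sub_distrib]
  congr 1
  simp only [← C_mul_X_pow_eq_monomial, ← smul_eq_C_mul, Finset.sum_mul, smul_mul_assoc,
    map_sum, map_smul, smul_eq_mul]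

include hσ hc in
lemma differentiable_coeff_orthoPoly (n : ℕ) :
    ∀ k, Differentiable ℝ fun s => (orthoPoly σ c s n).coeff k := by
  induction n using Nat.strong_induction_on with
  | _ n ih =>
    have hdiff : ∀ j < n, ∀ Q : ℝ[X],
        Differentiable ℝ fun s => momentFunctional hσ hc s (orthoPoly σ c s j * Q) :=
      fun j hj Q s => (hasDerivAt_momentFunctional_mul hσ hc s Q (N := j + 1)
        (fun u => by rw [natDegree_orthoPoly]; lia)
        (fun k => (ih j hj k s).hasDerivAt)).differentiableAt
    intro k
    -- In the denominators the second S_j is replaced by x^j, another monic polynomial of degree j,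
    -- so only one factor varies with s.
    have hcoeff : (fun s => (orthoPoly σ c s n).coeff k) = fun s => (X ^ n : ℝ[X]).coeff k -
        ∑ j : Fin n, momentFunctional hσ hc s (orthoPoly σ c s j * X ^ n) /
          momentFunctional hσ hc s (orthoPoly σ c s j * X ^ (j : ℕ)) *
            (orthoPoly σ c s j).coeff k := by
      ext s
      rw [orthoPoly, coeff_sub, finsetSum_coeff]
      congr 1
      refine Finset.sum_congr rfl fun j _ => ?_
      rw [coeff_C_mul, innerW_eq_momentFunctional hσ hc, innerW_eq_momentFunctional hσ hc,
        mul_comm (X ^ n), momentFunctional_orthoPoly_mul_monic hσ hc s (monic_X_pow j)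
          (natDegree_X_pow _), sqNorm]
    rw [hcoeff]
    refine (differentiable_const _).sub (Differentiable.fun_sum fun j _ => ?_)
    refine ((hdiff j j.isLt _).div (hdiff j j.isLt _) fun s => ?_).mul (ih j j.isLt k)
    rw [momentFunctional_orthoPoly_mul_monic hσ hc s (monic_X_pow j) (natDegree_X_pow _)]
    exact (sqNorm_pos hσ hc s j).ne'

/-- One factor can be frozen at t, since pairing S_n(·; s) with any monic polynomial of degree n
gives h_n(s). The derivative of the moving factor has degree below n and is orthogonal to S_n(·; t),
so only the weight contributes. -/
lemma hasDerivAt_sqNorm (n : ℕ) :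
    HasDerivAt (fun s => sqNorm hσ hc s n)
      ((gam σ c n t + gam σ c (n + 1) t - Xi σ c n t - Xi σ c (n + 1) t) * sqNorm hσ hc t n) t := by
  have h := hasDerivAt_momentFunctional_mul hσ hc t (orthoPoly σ c t n)
    (P := fun s => orthoPoly σ c s n) (N := n + 1)
    (fun s => by rw [natDegree_orthoPoly]; lia)
    (fun k => (differentiable_coeff_orthoPoly hσ hc n k t).hasDerivAt)
  have hlead : deriv (fun s => (orthoPoly σ c s n).coeff n) t = 0 := by
    have : (fun s => (orthoPoly σ c s n).coeff n) = fun _ => 1 := by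
      ext s
      have := (orthoPoly_monic σ c s n).coeff_natDegree
      rwa [natDegree_orthoPoly] at this
    rw [this, deriv_const]
  have hnorm : (fun s => momentFunctional hσ hc s (orthoPoly σ c s n * orthoPoly σ c t n)) =
      fun s => sqNorm hσ hc s n := by
    ext s
    exact momentFunctional_orthoPoly_mul_monic hσ hc s (orthoPoly_monic σ c t n)
      (natDegree_orthoPoly σ c t n)
  have hlow : momentFunctional hσ hc t ((∑ k ∈ Finset.range (n + 1),
      monomial k (deriv (fun s => (orthoPoly σ c s n).coeff k) t)) * orthoPoly σ c t n) = 0 := by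
    rw [Finset.sum_range_succ, hlead, map_zero, add_zero, mul_comm]
    refine momentFunctional_orthoPoly_mul_eq_zero hσ hc t ?_
    rw [degree_lt_iff_coeff_zero]
    intro m hm
    rw [finsetSum_coeff]
    refine Finset.sum_eq_zero fun k hk => coeff_monomial_of_ne _ ?_
    have := Finset.mem_range.mp hk
    lia
  rw [hnorm, hlow] at h
  refine h.congr_deriv ?_
  have h2 := momentForm_X_sq hσ hc t n
  have h4 := momentForm_X_sq_X_sq hσ hc t n
  rw [momentForm_apply] at h2 h4
  have hsplit : (X ^ 4 - X ^ 2) * (orthoPoly σ c t n * orthoPoly σ c t n) =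
      X ^ 2 * orthoPoly σ c t n * (X ^ 2 * orthoPoly σ c t n) -
        X ^ 2 * orthoPoly σ c t n * orthoPoly σ c t n := by ring
  rw [hsplit, map_sub, h2, h4]
  ring

include hσ hc in
/-- The differential-difference (Volterra type) equation for the recurrence coefficients. -/
lemma hasDerivAt_gam (k : ℤ) :
    HasDerivAt (gam σ c k) (gam σ c k t * (Xi σ c (k - 1) t - Xi σ c (k + 1) t +
      gam σ c (k + 1) t - gam σ c (k - 1) t)) t := by
  rcases le_or_gt k 0 with hk | hk
  · have : gam σ c k = fun _ => 0 := funext fun s => gam_of_nonpos σ c s hk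
    rw [this, zero_mul]
    exact hasDerivAt_const t 0
  · obtain ⟨n, rfl⟩ : ∃ n : ℕ, k = n + 1 := ⟨(k - 1).toNat, by lia⟩
    have hg : gam σ c (n + 1) = fun s => sqNorm hσ hc s (n + 1) / sqNorm hσ hc s n :=
      funext fun s => gam_add_one hσ hc s n
    have hne := (sqNorm_pos hσ hc t n).ne'
    -- In the difference of logarithmic derivatives, γ_{n+1} and Ξ_{n+1} cancel.
    have h := (hasDerivAt_sqNorm hσ hc t (n + 1)).div (hasDerivAt_sqNorm hσ hc t n) hne
    rw [gam_add_one hσ hc t n, add_sub_cancel_right]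
    push_cast at h
    rw [hg]
    refine h.congr_deriv ?_
    field_simp
    ring

end OrthogonalPolynomials

/-! ### The second derivative -/

/-- The string equation solved for the term carrying 1/(6c), and extended to n = 0, where both sides
vanish. -/
lemma one_div_mul_string {σ c : ℝ} (hσ : 0 < σ) (hc : 0 < c) (n : ℕ) (t : ℝ) :
    1 / (6 * c) * ((n : ℝ) + (2 * σ + 1) * Om n - vartheta σ c n t) =
      gam σ c n t * (gam σ c (n + 1) t * (gam σ c (n - 1) t + gam σ c n t +
        gam σ c (n + 1) t + gam σ c (n + 2) t) + Xi σ c (n - 1) t + Xi σ c n t) := by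
  rcases n with _ | n
  · simp [Om, vartheta, Xi, gam_zero]
  · have h := string_equation hσ hc t n
    have i2 : (n : ℤ) + 1 + 2 = n + 3 := by ring
    push_cast
    rw [add_sub_cancel_right, add_assoc (n : ℤ), one_add_one_eq_two, i2, h]
    field_simp
    ring

/-- The Volterra equation holds for every s, so it is an identity of functions and may be
differentiated again. -/
lemma hasDerivAt_deriv_gam {σ c : ℝ} (hσ : 0 < σ) (hc : 0 < c) (t : ℝ) (k : ℤ) :
    HasDerivAt (deriv (gam σ c k))
      (gam σ c k t * (Xi σ c (k - 1) t - Xi σ c (k + 1) t +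
          gam σ c (k + 1) t - gam σ c (k - 1) t) *
        (Xi σ c (k - 1) t - Xi σ c (k + 1) t + gam σ c (k + 1) t - gam σ c (k - 1) t) +
      gam σ c k t * (deriv (Xi σ c (k - 1)) t - deriv (Xi σ c (k + 1)) t +
        deriv (gam σ c (k + 1)) t - deriv (gam σ c (k - 1)) t)) t := by
  have hg := fun j => hasDerivAt_gam hσ hc t j
  have hXi : ∀ j, HasDerivAt (Xi σ c j) (deriv (Xi σ c j) t) t := fun j =>
    ((hg j).mul (((hg (j - 1)).add (hg j)).add (hg (j + 1)))).differentiableAt.hasDerivAt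
  have hderiv : deriv (gam σ c k) = fun s => gam σ c k s * (Xi σ c (k - 1) s - Xi σ c (k + 1) s +
      gam σ c (k + 1) s - gam σ c (k - 1) s) := funext fun s => (hasDerivAt_gam hσ hc s k).deriv
  rw [hderiv, (hg (k + 1)).deriv, (hg (k - 1)).deriv]
  exact (hg k).mul ((((hXi (k - 1)).sub (hXi (k + 1))).add (hg (k + 1))).sub (hg (k - 1)))

lemma deriv_Xi {σ c : ℝ} (hσ : 0 < σ) (hc : 0 < c) (t : ℝ) (k : ℤ) :
    deriv (Xi σ c k) t =
      deriv (gam σ c k) t * (gam σ c (k - 1) t + gam σ c k t + gam σ c (k + 1) t) +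
        gam σ c k t * (deriv (gam σ c (k - 1)) t + deriv (gam σ c k) t +
          deriv (gam σ c (k + 1)) t) := by
  have hg := fun j => (hasDerivAt_gam hσ hc t j).differentiableAt.hasDerivAt
  exact ((hg k).mul (((hg (k - 1)).add (hg k)).add (hg (k + 1)))).deriv

end PerturbedFreud

theorem mainTheorem5 (σ c : ℝ) (hσ : 0 < σ) (hc : 0 < c) (n : ℕ) (t : ℝ) :
    let m : ℤ := (n : ℤ)
    let g : ℤ → ℝ := fun k => PerturbedFreud.gam σ c k t
    (∀ s : ℝ, DifferentiableAt ℝ (PerturbedFreud.gam σ c m) s) ∧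
      HasDerivAt (deriv (PerturbedFreud.gam σ c m))
        (1 / (6 * c) *
            ((n : ℝ) + (2 * σ + 1) * PerturbedFreud.Om n - PerturbedFreud.vartheta σ c m t)
            + (-g (m - 1) - g (m + 1)) * g m ^ 4 + (-g (m - 2) * g (m - 1) - g (m - 1) ^ 2
            - 6 * g (m - 1) * g (m + 1) - g (m + 1) ^ 2 - g (m + 1) * g (m + 2) + 2 * g (m - 1)
            + 2 * g (m + 1)) * g m ^ 3 + (g (m - 3) * g (m - 2) * g (m - 1)
            + g (m - 2) ^ 2 * g (m - 1) + 2 * g (m - 2) * g (m - 1) ^ 2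
            - 4 * g (m - 2) * g (m - 1) * g (m + 1) + g (m - 1) ^ 3 - 5 * g (m - 1) ^ 2 * g (m + 1)
            - 4 * g (m - 1) * g (m + 1) * g (m + 2) - 5 * g (m - 1) * g (m + 1) ^ 2 + g (m + 1) ^ 3
            + 2 * g (m + 1) ^ 2 * g (m + 2) + g (m + 1) * g (m + 2) ^ 2
            + g (m + 1) * g (m + 2) * g (m + 3) + 8 * g (m - 1) * g (m + 1) - g (m - 1)
            - g (m + 1)) * g m ^ 2 + (g (m - 4) * g (m - 3) * g (m - 2) * g (m - 1)
            + g (m - 3) ^ 2 * g (m - 2) * g (m - 1) + 2 * g (m - 3) * g (m - 2) ^ 2 * g (m - 1)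
            + 2 * g (m - 3) * g (m - 2) * g (m - 1) ^ 2 + g (m - 2) ^ 3 * g (m - 1)
            + 3 * g (m - 2) ^ 2 * g (m - 1) ^ 2 + 3 * g (m - 2) * g (m - 1) ^ 3
            - 2 * g (m - 2) * g (m - 1) * g (m + 1) ^ 2
            - 2 * g (m - 2) * g (m - 1) * g (m + 1) * g (m + 2) + g (m - 1) ^ 4
            - 2 * g (m - 1) ^ 2 * g (m + 1) ^ 2 - 2 * g (m - 1) ^ 2 * g (m + 1) * g (m + 2)
            + g (m + 1) ^ 4 + 3 * g (m + 1) ^ 3 * g (m + 2) + 3 * g (m + 1) ^ 2 * g (m + 2) ^ 2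
            + 2 * g (m + 1) ^ 2 * g (m + 2) * g (m + 3) + g (m + 1) * g (m + 2) ^ 3
            + 2 * g (m + 1) * g (m + 2) ^ 2 * g (m + 3) + g (m + 1) * g (m + 2) * g (m + 3) ^ 2
            - 2 * g (m - 2) ^ 2 * g (m - 1) + g (m + 1) * g (m + 2) * g (m + 3) * g (m + 4)
            - 2 * g (m - 3) * g (m - 2) * g (m - 1) - 4 * g (m - 2) * g (m - 1) ^ 2
            + 2 * g (m - 2) * g (m - 1) * g (m + 1) - 2 * g (m - 1) ^ 3
            + 2 * g (m - 1) ^ 2 * g (m + 1) + 2 * g (m - 1) * g (m + 1) ^ 2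
            + 2 * g (m - 1) * g (m + 1) * g (m + 2) - 2 * g (m + 1) ^ 3
            - 4 * g (m + 1) ^ 2 * g (m + 2) - g m ^ 2 - 2 * g (m + 1) * g (m + 2) ^ 2
            - 2 * g (m + 1) * g (m + 2) * g (m + 3) - 2 * g (m - 1) * g (m + 1) - 2 * g m * g (m - 1)
            - 2 * g m * g (m + 1) - g (m + 1) * g (m - 1)) * g m) t ∧
      PerturbedFreud.vartheta σ c m t =
        2 * t * g m * (2 * (g (m - 1) + g m + g (m + 1)) - 1) := by
  intro m g
  refine ⟨fun s => (PerturbedFreud.hasDerivAt_gam hσ hc s m).differentiableAt, ?_, ?_⟩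
  · refine (PerturbedFreud.hasDerivAt_deriv_gam hσ hc t m).congr_deriv ?_
    -- This removes all explicit n, σ, c and t, leaving a polynomial identity in the γ's.
    rw [PerturbedFreud.one_div_mul_string hσ hc]
    simp only [PerturbedFreud.deriv_Xi hσ hc, fun k => (PerturbedFreud.hasDerivAt_gam hσ hc t k).deriv,
      PerturbedFreud.Xi, g]
    have i1 : m - 1 - 1 = m - 2 := by ring
    have i2 : m - 2 - 1 = m - 3 := by ring
    have i3 : m - 3 - 1 = m - 4 := by ring
    have i4 : m - 1 + 1 = m := by ring
    have i5 : m - 2 + 1 = m - 1 := by ring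
    have i6 : m - 3 + 1 = m - 2 := by ring
    have j1 : m + 1 + 1 = m + 2 := by ring
    have j2 : m + 2 + 1 = m + 3 := by ring
    have j3 : m + 3 + 1 = m + 4 := by ring
    have j4 : m + 1 - 1 = m := by ring
    have j5 : m + 2 - 1 = m + 1 := by ring
    have j6 : m + 3 - 1 = m + 2 := by ring
    -- Shifted indices are normalised so that `ring` sees equal coefficients as the same atom.
    simp only [i1, i2, i3, i4, i5, i6, j1, j2, j3, j4, j5, j6, show (n : ℤ) = m from rfl]
    ring
  · simp only [PerturbedFreud.vartheta, PerturbedFreud.Xi, g]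
    ring
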